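/- For a partition $\pi$ of $[n]=\{1,\dots,n\}$ into nonempty pairwise disjoint blocks, an edge of $\pi$ is a pair $(i,j)$ with $i<j$ such that $i,j$ lie in the same block $B$ of $\pi$ and no $p\in B$ satisfies $i<p<j$. A linear crossing of $\pi$ is a sequence $(i_1,j_1),(i_2,j_2)$ of edges of $\pi$ with $i_1<i_2<j_1<j_2$. Let $S_{n,k}$ (Stirling number of the second kind) be the number of partitions of an $n$-element set into $k$ blocks and $B_n$ (Bell number) the number of all partitions of an $n$-element set. Let $\mu_n$ be the average number of linear crossings over all partitions of $[n]$, and, for $1\le k\le n$, let $\mu_{n,k}$ be the average over all partitions of $[n]$ into exactly $k$ blocks. (a) For every $n\ge 0$, $$\mu_n=-\frac54\,\frac{B_{n+2}}{B_n}+\left(\frac n2+\frac94\right)\frac{B_{n+1}}{B_n}+\frac n2+\frac14,$$ and, as $n\to\infty$, $$\mu_n=\frac{n^2}{2\log n}\left(1+\frac{\log\log n}{\log n}\,(1+o(1))\right).$$ (b) For all integers $1\le k\le n$, $$\mu_{n,k}=\frac12\,n(k-1)-\frac52\binom k2+\frac32\,(n+1-k)\,\frac{S_{n,k-1}}{S_{n,k}},$$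 and, for each fixed $k\ge 1$, as $n\to\infty$, $$\mu_{n,k}=\frac12\,n(k-1)-\frac52\binom k2+o(1).$$ -/

import Mathlib

open Filter Topology

namespace LinearCrossing

/-- The partitions of `[n] = {1, …, n}` into nonempty, pairwise disjoint blocks. -/
abbrev SetPartition (n : ℕ) : Type := Finpartition (Finset.Icc 1 n)

/-- The edges of the linear representation of `π`: the pairs `(i, j)` with `i < j` of elements of
the same block `B` that are consecutive in `B`. -/
def edges {n : ℕ} (π : SetPartition n) : Finset (ℕ × ℕ) :=
  (Finset.Icc 1 n ×ˢ Finset.Icc 1 n).filter fun e =>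
    e.1 < e.2 ∧ ∃ B ∈ π.parts, e.1 ∈ B ∧ e.2 ∈ B ∧ ∀ p ∈ B, ¬(e.1 < p ∧ p < e.2)

/-- The linear crossings of `π`: the sequences `(i₁, j₁), (i₂, j₂)` of edges of `π` with
`i₁ < i₂ < j₁ < j₂`. -/
def crossings {n : ℕ} (π : SetPartition n) : Finset ((ℕ × ℕ) × (ℕ × ℕ)) :=
  (edges π ×ˢ edges π).filter fun c =>
    c.1.1 < c.2.1 ∧ c.2.1 < c.1.2 ∧ c.1.2 < c.2.2

/-- The number of linear crossings of `π`. -/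
def cro {n : ℕ} (π : SetPartition n) : ℕ := (crossings π).card

/-- The partitions of `[n]` into exactly `k` blocks. -/
def kPartitions (n k : ℕ) : Finset (SetPartition n) :=
  Finset.univ.filter fun π => π.parts.card = k

/-- The average number of linear crossings in a uniformly random partition of `[n]`. -/
noncomputable def meanCro (n : ℕ) : ℝ :=
  (∑ π : SetPartition n, (cro π : ℝ)) / (Fintype.card (SetPartition n) : ℝ)

/-- The average number of linear crossings in a uniformly random partition of `[n]` into `k`
blocks (such partitions exist when `1 ≤ k ≤ n`). -/
noncomputable def meanCroBlocks (n k : ℕ) : ℝ :=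
  (∑ π ∈ kPartitions n k, (cro π : ℝ)) / ((kPartitions n k).card : ℝ)

end LinearCrossing

/-!
The exact formulas come from building a partition of `[n + 1]` out of a partition `π` of `[n]`: the
point `n + 1` either forms a block of its own or joins a block `o` of `π`. In the latter case the
only new edge goes from `max o` to `n + 1`, and it crosses exactly the edges of `π` that pass over
`max o` (`cro_extend`). Thus one needs the auxiliary statistic `coverSum π`, the number of pairs of
an edge and a block such that the edge passes over the maximum of the block. It satisfies a similar
rule (`coverSum_extend`), in which the only new ingredient is the number of blocks with a maximum
larger than `max o`; summed over `o` this is `k.choose 2`, because the maxima of the blocks are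
distinct. The two recursions that result (`sum_cro_succ`, `sum_coverSum_succ`) close up and are
solved by explicit combinations of Stirling numbers (`sum_coverSum_eq`, `sum_cro_eq`). Summation
over the number of blocks expresses the total through Bell numbers (`sum_cro`).

For a fixed number `k` of blocks the limit follows from the bounds
`k ^ (n - k) ≤ S(n, k)` and `S(n, k - 1) ≤ (n + 1) ^ (k - 1) * (k - 1) ^ n`.

The expansion of the mean over all partitions rests on sharp bounds for the ratio
`R = B_{n+1} / B_n`. By Dobiński's formula `e * B_n = ∑ m ^ n / m!`, so that `R` is a mean with
respect to the weights `m ^ n / m!`. Shifting the index of summation expresses `B_{n+1}` and `B_n`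
as integrals of `(1 + 1 / m) ^ n` and `(1 - 1 / m) ^ n`, and convexity gives `(1 + 1 / R) ^ n ≤ R`
and `(1 - 1 / R) ^ n ≤ 1 / R`. Taking logarithms, `(R - 1) log R ≤ n ≤ (R + 1) log R`, from which
`R = n / log n * (1 + log log n / log n * (1 + o(1)))` (`tendsto_of_mul_log_bounds`). In the formula
for the mean, `n * R / 2` provides both leading terms and everything else is `O(n² / log² n)`.
-/

namespace LinearCrossing

/-! ### Extending a partition of `[n]` to a partition of `[n + 1]` -/

variable {n : ℕ}

theorem mem_edges {π : SetPartition n} {e : ℕ × ℕ} :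
    e ∈ edges π ↔
      e.1 < e.2 ∧ ∃ B ∈ π.parts, e.1 ∈ B ∧ e.2 ∈ B ∧ ∀ p ∈ B, ¬(e.1 < p ∧ p < e.2) := by
  simp only [edges, Finset.mem_filter, Finset.mem_product, and_iff_right_iff_imp]
  rintro ⟨-, B, hB, h1, h2, -⟩
  exact ⟨π.subset hB h1, π.subset hB h2⟩

theorem le_of_mem_part {π : SetPartition n} {B : Finset ℕ} (hB : B ∈ π.parts) {p : ℕ}
    (hp : p ∈ B) : p ≤ n :=
  (Finset.mem_Icc.1 (π.subset hB hp)).2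

theorem snd_le_of_mem_edges {π : SetPartition n} {e : ℕ × ℕ} (he : e ∈ edges π) : e.2 ≤ n := by
  obtain ⟨-, B, hB, -, h2, -⟩ := mem_edges.1 he
  exact le_of_mem_part hB h2

theorem mem_crossings {π : SetPartition n} {c : (ℕ × ℕ) × (ℕ × ℕ)} :
    c ∈ crossings π ↔
      (c.1 ∈ edges π ∧ c.2 ∈ edges π) ∧ c.1.1 < c.2.1 ∧ c.2.1 < c.1.2 ∧ c.1.2 < c.2.2 := by
  simp only [crossings, Finset.mem_filter, Finset.mem_product]

theorem mem_kPartitions {k : ℕ} {π : SetPartition n} :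
    π ∈ kPartitions n k ↔ π.parts.card = k := by
  simp [kPartitions]

/-- For a block `o` of `π`, the partition of `[n+1]` obtained from `π` by putting `n + 1` into `o`.
The value `o = ∅` is allowed and makes `{n + 1}` a block of its own, so that both ways of extending
a partition are treated at once. -/
def extend (π : SetPartition n) (o : Finset ℕ) (ho : o ∈ insert ∅ π.parts) :
    SetPartition (n + 1) :=
  Finpartition.ofExistsUnique (insert (insert (n + 1) o) (π.parts.erase o))
    (by
      intro p hp
      rw [Finset.mem_insert, Finset.mem_erase] at hp
      intro x hx
      have key : ∀ B ∈ π.parts, x ∈ B → x ∈ Finset.Icc 1 (n + 1) := fun B hB hxB =>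
        Finset.Icc_subset_Icc_right (Nat.le_succ n) (π.subset hB hxB)
      rcases hp with rfl | ⟨-, hp⟩
      · rcases Finset.mem_insert.1 hx with rfl | hx
        · simp
        · rcases Finset.mem_insert.1 ho with rfl | ho
          · simp at hx
          · exact key o ho hx
      · exact key p hp hx)
    (by
      intro a ha
      have hlt : ∀ B ∈ π.parts, n + 1 ∉ B := fun B hB h => by
        have := le_of_mem_part hB h; omega
      by_cases han : a = n + 1
      · subst han
        refine ⟨insert (n + 1) o, ⟨by simp, by simp⟩, ?_⟩
        rintro B ⟨hB, hnB⟩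
        rcases Finset.mem_insert.1 hB with h | h
        · exact h
        · exact absurd hnB (hlt B (Finset.mem_of_mem_erase h))
      · have ha' : a ∈ Finset.Icc 1 n := by
          rw [Finset.mem_Icc] at ha ⊢; omega
        obtain ⟨B, hB, haB⟩ := π.exists_mem ha'
        by_cases hBo : B = o
        · subst hBo
          refine ⟨insert (n + 1) B, ⟨by simp, by simp [haB]⟩, ?_⟩
          rintro C ⟨hC, haC⟩
          rcases Finset.mem_insert.1 hC with h | h
          · exact h
          · rw [Finset.mem_erase] at h
            exact absurd (π.eq_of_mem_parts h.2 hB haC haB) h.1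
        · refine ⟨B, ⟨by simp [hB, hBo], haB⟩, ?_⟩
          rintro C ⟨hC, haC⟩
          rcases Finset.mem_insert.1 hC with h | h
          · subst h
            rcases Finset.mem_insert.1 haC with h' | h'
            · exact absurd h' han
            · rcases Finset.mem_insert.1 ho with rfl | ho
              · simp at h'
              · exact absurd (π.eq_of_mem_parts hB ho haB h') hBo
          · exact π.eq_of_mem_parts (Finset.mem_of_mem_erase h) hB haC haB)
    (by
      intro h
      rcases Finset.mem_insert.1 h with h | h
      · exact absurd h.symm (Finset.insert_ne_empty _ _)
      · exact π.empty_notMem_parts (Finset.mem_of_mem_erase h))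

theorem parts_extend (π : SetPartition n) (o : Finset ℕ) (ho : o ∈ insert ∅ π.parts) :
    (extend π o ho).parts = insert (insert (n + 1) o) (π.parts.erase o) := rfl

theorem succ_notMem_of_mem_parts {π : SetPartition n} {B : Finset ℕ} (hB : B ∈ π.parts) :
    n + 1 ∉ B := fun h => by
  have := le_of_mem_part hB h; omega

theorem succ_notMem_of_mem_insert {π : SetPartition n} {o : Finset ℕ}
    (ho : o ∈ insert ∅ π.parts) : n + 1 ∉ o := by
  rcases Finset.mem_insert.1 ho with rfl | ho
  · simp
  · exact succ_notMem_of_mem_parts ho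

theorem insert_succ_notMem (π : SetPartition n) (o : Finset ℕ) :
    insert (n + 1) o ∉ π.parts.erase o := fun h =>
  succ_notMem_of_mem_parts (Finset.mem_of_mem_erase h) (Finset.mem_insert_self _ _)

theorem extend_injective :
    Function.Injective fun x : Σ π : SetPartition n, {o // o ∈ insert ∅ π.parts} =>
      extend x.1 x.2.1 x.2.2 := by
  rintro ⟨π, o, ho⟩ ⟨π', o', ho'⟩ h
  have hp : (extend π o ho).parts = (extend π' o' ho').parts := congrArg _ h
  rw [parts_extend, parts_extend] at hp
  -- the block of `n + 1` determines `o`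
  have hoo : o = o' := by
    have h1 : insert (n + 1) o ∈ insert (insert (n + 1) o') (π'.parts.erase o') := by
      rw [← hp]; exact Finset.mem_insert_self _ _
    rcases Finset.mem_insert.1 h1 with h1 | h1
    · rw [← Finset.erase_insert (succ_notMem_of_mem_insert ho), h1,
        Finset.erase_insert (succ_notMem_of_mem_insert ho')]
    · exact absurd (Finset.mem_insert_self _ _)
        (succ_notMem_of_mem_parts (Finset.mem_of_mem_erase h1))
  subst hoo
  have he : π.parts.erase o = π'.parts.erase o := by
    rw [← Finset.erase_insert (insert_succ_notMem π o), hp,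
      Finset.erase_insert (insert_succ_notMem π' o)]
  have hpp : π.parts = π'.parts := by
    by_cases hoe : o = ∅
    · subst hoe
      rwa [Finset.erase_eq_of_notMem π.empty_notMem_parts,
        Finset.erase_eq_of_notMem π'.empty_notMem_parts] at he
    · have h1 := (Finset.mem_insert.1 ho).resolve_left hoe
      have h2 := (Finset.mem_insert.1 ho').resolve_left hoe
      rw [← Finset.insert_erase h1, he, Finset.insert_erase h2]
  have : π = π' := Finpartition.ext hpp
  subst this
  rfl

theorem extend_surjective :
    Function.Surjective fun x : Σ π : SetPartition n, {o // o ∈ insert ∅ π.parts} =>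
      extend x.1 x.2.1 x.2.2 := by
  intro ρ
  have hs : Finset.Icc 1 (n + 1) \ {n + 1} = Finset.Icc 1 n := by
    ext x; simp only [Finset.mem_sdiff, Finset.mem_Icc, Finset.mem_singleton]; omega
  have hn : n + 1 ∈ Finset.Icc 1 (n + 1) := by simp
  obtain ⟨C, hC, hnC⟩ := ρ.exists_mem hn
  let π : SetPartition n := (ρ.avoid {n + 1}).copy hs
  have hπ : ∀ B, B ∈ π.parts ↔ ∃ d ∈ ρ.parts, ¬ d ≤ {n + 1} ∧ d \ {n + 1} = B := fun B =>
    ρ.mem_avoid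
  have hother : ∀ B ∈ ρ.parts, B ≠ C → n + 1 ∉ B := fun B hB hne h =>
    hne (ρ.eq_of_mem_parts hB hC h hnC)
  have ho : C.erase (n + 1) ∈ insert ∅ π.parts := by
    rw [Finset.mem_insert, hπ]
    by_cases h : C.erase (n + 1) = ∅
    · exact Or.inl h
    · refine Or.inr ⟨C, hC, fun hle => h ?_, Finset.sdiff_singleton_eq_erase _ _⟩
      rw [← Finset.sdiff_singleton_eq_erase]
      exact Finset.sdiff_eq_empty_iff_subset.2 hle
  refine ⟨⟨π, C.erase (n + 1), ho⟩, Finpartition.ext ?_⟩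
  change (extend π (C.erase (n + 1)) ho).parts = ρ.parts
  rw [parts_extend, Finset.insert_erase hnC]
  ext B
  rw [Finset.mem_insert, Finset.mem_erase, hπ]
  constructor
  · rintro (rfl | ⟨hne, d, hd, -, rfl⟩)
    · exact hC
    · by_cases hdC : d = C
      · subst hdC
        exact absurd (Finset.sdiff_singleton_eq_erase _ _) hne
      · rwa [Finset.sdiff_singleton_eq_erase, Finset.erase_eq_of_notMem (hother d hd hdC)]
  · intro hB
    by_cases hBC : B = C
    · exact Or.inl hBC
    · have hnB := hother B hB hBC
      refine Or.inr ⟨?_, B, hB, ?_, ?_⟩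
      · rintro rfl
        obtain ⟨x, hx⟩ := ρ.nonempty_of_mem_parts hB
        exact hBC (ρ.eq_of_mem_parts hB hC hx (Finset.mem_of_mem_erase hx))
      · intro hle
        obtain ⟨x, hx⟩ := ρ.nonempty_of_mem_parts hB
        have : x = n + 1 := Finset.mem_singleton.1 (hle hx)
        exact hnB (this ▸ hx)
      · rw [Finset.sdiff_singleton_eq_erase, Finset.erase_eq_of_notMem hnB]

/-- Every partition of `[n + 1]` is `extend π o` for exactly one `π` and one `o`, which is a block of
`π` or empty. -/
theorem sum_succ (f : SetPartition (n + 1) → ℝ) :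
    ∑ ρ, f ρ = ∑ π : SetPartition n, ∑ o ∈ (insert ∅ π.parts).attach, f (extend π o.1 o.2) := by
  rw [← Fintype.sum_bijective _ ⟨extend_injective, extend_surjective⟩
    (fun x => f (extend x.1 x.2.1 x.2.2)) f (fun _ => rfl), Fintype.sum_sigma]
  rfl

theorem card_parts_extend_empty (π : SetPartition n) :
    (extend π ∅ (Finset.mem_insert_self _ _)).parts.card = π.parts.card + 1 := by
  rw [parts_extend, Finset.card_insert_of_notMem (insert_succ_notMem π ∅),
    Finset.erase_eq_of_notMem π.empty_notMem_parts]

theorem card_parts_extend_of_mem (π : SetPartition n) {o : Finset ℕ} (ho : o ∈ π.parts) :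
    (extend π o (Finset.mem_insert_of_mem ho)).parts.card = π.parts.card := by
  rw [parts_extend, Finset.card_insert_of_notMem (insert_succ_notMem π o),
    Finset.card_erase_add_one ho]

theorem sum_kPartitions_succ (k : ℕ) (f : SetPartition (n + 1) → ℝ) :
    ∑ ρ ∈ kPartitions (n + 1) (k + 1), f ρ =
      ∑ π ∈ kPartitions n k, f (extend π ∅ (Finset.mem_insert_self _ _)) +
      ∑ π ∈ kPartitions n (k + 1), ∑ o ∈ π.parts.attach,
        f (extend π o.1 (Finset.mem_insert_of_mem o.2)) := by
  rw [kPartitions, Finset.sum_filter, sum_succ, kPartitions, kPartitions, Finset.sum_filter,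
    Finset.sum_filter, ← Finset.sum_add_distrib]
  refine Finset.sum_congr rfl fun π _ => ?_
  rw [Finset.attach_insert, Finset.sum_insert, Finset.sum_image, card_parts_extend_empty]
  · simp only [add_left_inj]
    congr 1
    split_ifs with h
    · exact Finset.sum_congr rfl fun o _ => by
        rw [if_pos ((card_parts_extend_of_mem π o.2).trans h)]
    · exact Finset.sum_eq_zero fun o _ => by
        rw [if_neg (by rwa [card_parts_extend_of_mem π o.2])]
  · intro a _ b _ h
    exact Subtype.ext (by simpa using h)
  · intro h
    obtain ⟨x, -, hx⟩ := Finset.mem_image.1 h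
    have : x.1 = ∅ := congrArg Subtype.val hx
    exact π.empty_notMem_parts (this ▸ x.2)

/-! ### Crossings and covered maxima under extension -/

/-- The number of edges of `π` that pass over the point `b`. -/
def cover (π : SetPartition n) (b : ℕ) : ℕ :=
  ((edges π).filter fun e => e.1 < b ∧ b < e.2).card

/-- The number of pairs of an edge and a block of `π` such that the edge passes over the maximum
of the block. -/
def coverSum (π : SetPartition n) : ℕ := ∑ B ∈ π.parts, cover π (B.sup id)

theorem cover_zero (π : SetPartition n) : cover π 0 = 0 := by
  simp [cover]

theorem sup_mem_of_nonempty {o : Finset ℕ} (h : o.Nonempty) : o.sup id ∈ o := by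
  obtain ⟨x, hx, h⟩ := Finset.exists_mem_eq_sup o h id
  rw [h]; exact hx

/-- Putting `n + 1` into a block `o` adds one edge, from the maximum `o.sup id` of `o`. -/
theorem mem_edges_extend {π : SetPartition n} {o : Finset ℕ} (ho : o ∈ insert ∅ π.parts)
    {e : ℕ × ℕ} :
    e ∈ edges (extend π o ho) ↔ e ∈ edges π ∨ (o.Nonempty ∧ e = (o.sup id, n + 1)) := by
  rw [mem_edges, mem_edges, parts_extend]
  constructor
  · rintro ⟨hlt, B, hB, h1, h2, h3⟩
    rw [Finset.mem_insert, Finset.mem_erase] at hB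
    rcases hB with rfl | ⟨-, hB⟩
    · have hle : ∀ x ∈ insert (n + 1) o, x ≤ n + 1 := by
        intro x hx
        rcases Finset.mem_insert.1 hx with rfl | hx
        · exact le_rfl
        · rcases Finset.mem_insert.1 ho with rfl | ho
          · simp at hx
          · exact (le_of_mem_part ho hx).trans (Nat.le_succ n)
      have h1o : e.1 ∈ o := by
        rcases Finset.mem_insert.1 h1 with h | h
        · have := hle _ h2; omega
        · exact h
      have hne : o.Nonempty := ⟨_, h1o⟩
      have ho' : o ∈ π.parts := (Finset.mem_insert.1 ho).resolve_left hne.ne_empty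
      rcases Finset.mem_insert.1 h2 with h | h
      · refine Or.inr ⟨hne, Prod.ext (le_antisymm (Finset.le_sup (f := id) h1o) ?_) h⟩
        refine Finset.sup_le fun p hp => ?_
        by_contra hlt'
        refine h3 p (Finset.mem_insert_of_mem hp) ⟨not_le.1 hlt', ?_⟩
        have := le_of_mem_part ho' hp
        omega
      · exact Or.inl ⟨hlt, o, ho', h1o, h, fun p hp => h3 p (Finset.mem_insert_of_mem hp)⟩
    · exact Or.inl ⟨hlt, B, hB, h1, h2, h3⟩
  · rintro (⟨hlt, B, hB, h1, h2, h3⟩ | ⟨hne, rfl⟩)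
    · refine ⟨hlt, ?_⟩
      by_cases hBo : B = o
      · subst hBo
        refine ⟨_, Finset.mem_insert_self _ _, Finset.mem_insert_of_mem h1,
          Finset.mem_insert_of_mem h2, fun p hp => ?_⟩
        rcases Finset.mem_insert.1 hp with rfl | hp
        · have := le_of_mem_part hB h2; omega
        · exact h3 p hp
      · exact ⟨B, by simp [hB, hBo], h1, h2, h3⟩
    · have ho' : o ∈ π.parts := (Finset.mem_insert.1 ho).resolve_left hne.ne_empty
      have hm := sup_mem_of_nonempty hne
      have := le_of_mem_part ho' hm
      refine ⟨by simp only; omega, _, Finset.mem_insert_self _ _, Finset.mem_insert_of_mem hm,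
        Finset.mem_insert_self _ _, fun p hp => ?_⟩
      rcases Finset.mem_insert.1 hp with rfl | hp
      · simp
      · have := Finset.le_sup (f := id) hp
        simp only [id] at this ⊢
        omega

/-- The new crossings are formed by the new edge with the edges that pass over the maximum of `o`.
For `o = ∅` the supremum is `0`, over which no edge passes, so the formula covers that case too. -/
theorem cro_extend (π : SetPartition n) (o : Finset ℕ) (ho : o ∈ insert ∅ π.parts) :
    cro (extend π o ho) = cro π + cover π (o.sup id) := by
  have hinj : Function.Injective fun e : ℕ × ℕ => (e, (o.sup id, n + 1)) := fun a b h =>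
    (Prod.ext_iff.1 h).1
  rw [cro, cro, cover, ← Finset.card_image_of_injective _ hinj, ← Finset.card_union_of_disjoint]
  · congr 1
    ext ⟨c, d⟩
    rw [Finset.mem_union, mem_crossings, mem_crossings, Finset.mem_image]
    simp only [mem_edges_extend, Finset.mem_filter, Prod.mk.injEq]
    constructor
    · rintro ⟨⟨hc, hd⟩, h1, h2, h3⟩
      rcases hc with hc | ⟨-, rfl⟩
      · rcases hd with hd | ⟨-, rfl⟩
        · exact Or.inl ⟨⟨hc, hd⟩, h1, h2, h3⟩
        · exact Or.inr ⟨c, ⟨hc, h1, h2⟩, rfl, rfl⟩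
      · rcases hd with hd | ⟨-, rfl⟩
        · have := snd_le_of_mem_edges hd
          simp only at h3
          omega
        · simp at h1
    · rintro (⟨⟨hc, hd⟩, h⟩ | ⟨e, ⟨he, h1, h2⟩, rfl, rfl⟩)
      · exact ⟨⟨Or.inl hc, Or.inl hd⟩, h⟩
      · refine ⟨⟨Or.inl he, Or.inr ⟨?_, rfl⟩⟩, h1, h2, ?_⟩
        · rw [Finset.nonempty_iff_ne_empty]
          rintro rfl
          simp at h1
        · have := snd_le_of_mem_edges he
          simp only
          omega
  · rw [Finset.disjoint_right]
    rintro _ hc hcr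
    obtain ⟨e, -, rfl⟩ := Finset.mem_image.1 hc
    have := snd_le_of_mem_edges (mem_crossings.1 hcr).1.2
    simp only at this
    omega

/-- The new edge starts at the maximum of `o` and so passes over exactly the larger
points of `[n]`. -/
theorem cover_extend_of_le (π : SetPartition n) (o : Finset ℕ) (ho : o ∈ insert ∅ π.parts) {b : ℕ}
    (hb : b ≤ n) :
    cover (extend π o ho) b = cover π b + if o.Nonempty ∧ o.sup id < b then 1 else 0 := by
  have hnot : (o.sup id, n + 1) ∉ edges π := fun h => by
    have := snd_le_of_mem_edges h
    simp only at this
    omega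
  rw [cover, cover]
  split_ifs with h
  · rw [← Finset.card_insert_of_notMem (a := (o.sup id, n + 1)) (fun h' => hnot (by simp_all))]
    congr 1
    ext e
    simp only [Finset.mem_filter, mem_edges_extend, Finset.mem_insert]
    constructor
    · rintro ⟨he | ⟨-, rfl⟩, h'⟩
      · exact Or.inr ⟨he, h'⟩
      · exact Or.inl rfl
    · rintro (rfl | ⟨he, h'⟩)
      · exact ⟨Or.inr ⟨h.1, rfl⟩, h.2, Nat.lt_succ_of_le hb⟩
      · exact ⟨Or.inl he, h'⟩
  · rw [add_zero]
    congr 1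
    ext e
    simp only [Finset.mem_filter, mem_edges_extend]
    constructor
    · rintro ⟨he | ⟨hne, rfl⟩, h'⟩
      · exact ⟨he, h'⟩
      · exact absurd ⟨hne, h'.1⟩ h
    · rintro ⟨he, h'⟩
      exact ⟨Or.inl he, h'⟩

theorem cover_self (π : SetPartition n) : cover π n = 0 := by
  rw [cover, Finset.card_eq_zero, Finset.filter_eq_empty_iff]
  intro e he h
  have := snd_le_of_mem_edges he
  omega

/-- The block `o` acquires the maximum `n + 1`, over which no edge passes, and every block with a
maximum beyond that of `o` is newly passed over once. -/
theorem coverSum_extend (π : SetPartition n) (o : Finset ℕ) (ho : o ∈ insert ∅ π.parts) :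
    coverSum (extend π o ho) + cover π (o.sup id) =
      coverSum π +
        if o.Nonempty then (π.parts.filter fun B => o.sup id < B.sup id).card else 0 := by
  have hsup : (insert (n + 1) o).sup id = n + 1 := by
    refine le_antisymm (Finset.sup_le fun p hp => ?_)
      (Finset.le_sup (f := id) (Finset.mem_insert_self _ _))
    rcases Finset.mem_insert.1 hp with rfl | hp
    · exact le_rfl
    · rcases Finset.mem_insert.1 ho with rfl | ho
      · simp at hp
      · exact (le_of_mem_part ho hp).trans (Nat.le_succ n)
  rw [coverSum, parts_extend, Finset.sum_insert (insert_succ_notMem π o), hsup, cover_self,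
    zero_add]
  have h1 : ∀ B ∈ π.parts.erase o, cover (extend π o ho) (B.sup id) =
      cover π (B.sup id) + if o.Nonempty ∧ o.sup id < B.sup id then 1 else 0 := fun B hB =>
    cover_extend_of_le π o ho
      (Finset.sup_le fun p hp => le_of_mem_part (Finset.mem_of_mem_erase hB) hp)
  rw [Finset.sum_congr rfl h1, Finset.sum_add_distrib]
  by_cases hne : o.Nonempty
  · have ho' : o ∈ π.parts := (Finset.mem_insert.1 ho).resolve_left hne.ne_empty
    have h2 := Finset.sum_erase_add π.parts (fun B => cover π (B.sup id)) ho'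
    have h3 := Finset.sum_erase_add π.parts
      (fun B => if o.Nonempty ∧ o.sup id < B.sup id then 1 else 0) ho'
    simp only [hne, lt_irrefl, and_false, if_false, add_zero, true_and] at h3
    rw [if_pos hne, Finset.card_filter, coverSum, ← h2, ← h3]
    simp only [hne, true_and]
    omega
  · rw [Finset.not_nonempty_iff_eq_empty] at hne
    subst hne
    simp [coverSum, cover_zero]

/-! ### Stirling numbers and the recursions for the block-restricted sums -/

/-- Each pair of distinct elements of `s` is counted once, by its member with the smaller value. -/
theorem sum_card_filter_lt {α : Type*} [DecidableEq α] (s : Finset α) (f : α → ℕ)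
    (hf : Set.InjOn f s) :
    ∑ a ∈ s, (s.filter fun b => f a < f b).card = s.card.choose 2 := by
  have hswap : ∑ a ∈ s, (s.filter fun b => f a < f b).card =
      ∑ a ∈ s, (s.filter fun b => f b < f a).card := by
    simp only [Finset.card_filter]
    exact Finset.sum_comm
  have htot : ∀ a ∈ s, (s.filter fun b => f a < f b).card + (s.filter fun b => f b < f a).card =
      s.card - 1 := by
    intro a ha
    rw [← Finset.card_erase_of_mem ha, ← Finset.card_union_of_disjoint]
    · congr 1
      ext b
      simp only [Finset.mem_union, Finset.mem_filter, Finset.mem_erase]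
      constructor
      · rintro (⟨hb, h⟩ | ⟨hb, h⟩) <;> exact ⟨by rintro rfl; exact lt_irrefl _ h, hb⟩
      · rintro ⟨hne, hb⟩
        rcases lt_trichotomy (f a) (f b) with h | h | h
        · exact Or.inl ⟨hb, h⟩
        · exact absurd (hf hb ha h.symm) hne
        · exact Or.inr ⟨hb, h⟩
    · exact Finset.disjoint_filter.2 fun b _ h h' => lt_asymm h h'
  have h2 := Finset.sum_congr rfl htot
  rw [Finset.sum_add_distrib, ← hswap, Finset.sum_const, smul_eq_mul] at h2
  rw [Nat.choose_two_right]
  omega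

theorem sum_card_sup_lt (π : SetPartition n) :
    ∑ o ∈ π.parts, (π.parts.filter fun B => o.sup id < B.sup id).card =
      π.parts.card.choose 2 := by
  refine sum_card_filter_lt _ _ fun B hB C hC h => ?_
  have hB' := sup_mem_of_nonempty (π.nonempty_of_mem_parts hB)
  have hC' := sup_mem_of_nonempty (π.nonempty_of_mem_parts hC)
  replace h : B.sup id = C.sup id := h
  rw [h] at hB'
  exact π.eq_of_mem_parts hB hC hB' hC'

theorem sum_cro_extend (π : SetPartition n) :
    ∑ o ∈ π.parts.attach, (cro (extend π o.1 (Finset.mem_insert_of_mem o.2)) : ℝ) =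
      π.parts.card * cro π + coverSum π := by
  simp only [cro_extend, Nat.cast_add, Finset.sum_add_distrib, Finset.sum_const, nsmul_eq_mul,
    Finset.card_attach, coverSum, Nat.cast_sum]
  rw [Finset.sum_attach π.parts fun o => (cover π (o.sup id) : ℝ)]

theorem sum_coverSum_extend (π : SetPartition n) :
    ∑ o ∈ π.parts.attach, (coverSum (extend π o.1 (Finset.mem_insert_of_mem o.2)) : ℝ) =
      (π.parts.card - 1) * coverSum π + π.parts.card.choose 2 := by
  have h : ∀ o ∈ π.parts.attach,
      (coverSum (extend π o.1 (Finset.mem_insert_of_mem o.2)) : ℝ) = coverSum π +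
        ((π.parts.filter fun B => o.1.sup id < B.sup id).card : ℝ) - cover π (o.1.sup id) := by
    intro o _
    have := coverSum_extend π o.1 (Finset.mem_insert_of_mem o.2)
    rw [if_pos (π.nonempty_of_mem_parts o.2)] at this
    rw [eq_sub_iff_add_eq]
    exact_mod_cast this
  rw [Finset.sum_congr rfl h, Finset.sum_sub_distrib, Finset.sum_add_distrib,
    Finset.sum_attach π.parts fun o => (cover π (o.sup id) : ℝ),
    Finset.sum_attach π.parts fun o =>
      ((π.parts.filter fun B => o.sup id < B.sup id).card : ℝ),
    ← Nat.cast_sum, ← Nat.cast_sum, sum_card_sup_lt, coverSum]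
  simp only [Finset.sum_const, nsmul_eq_mul, Finset.card_attach]
  push_cast
  ring

theorem kPartitions_succ_zero : kPartitions (n + 1) 0 = ∅ := by
  refine Finset.filter_eq_empty_iff.2 fun π _ h => ?_
  have := π.parts_nonempty (by simp [Finset.bot_eq_empty])
  exact this.ne_empty (Finset.card_eq_zero.1 h)

theorem card_parts_le (π : SetPartition n) : π.parts.card ≤ n := by
  simpa using π.card_parts_le_card

theorem card_kPartitions (n k : ℕ) : (kPartitions n k).card = n.stirlingSecond k := by
  induction n generalizing k with
  | zero =>
    cases k with
    | zero =>
      have h : kPartitions 0 0 = Finset.univ :=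
        Finset.filter_true_of_mem fun π _ => Nat.le_zero.1 (card_parts_le π)
      rw [h, Nat.stirlingSecond_zero, Finset.card_univ]
      exact Fintype.card_unique (α := Finpartition (⊥ : Finset ℕ))
    | succ k =>
      rw [Nat.stirlingSecond_zero_succ, Finset.card_eq_zero]
      refine Finset.filter_eq_empty_iff.2 fun π _ h => ?_
      have := card_parts_le π
      omega
  | succ n ih =>
    cases k with
    | zero => rw [kPartitions_succ_zero, Nat.stirlingSecond_succ_zero, Finset.card_empty]
    | succ k =>
      have h := sum_kPartitions_succ (n := n) k fun _ => 1
      have h2 : ∀ π ∈ kPartitions n (k + 1), ∑ _o ∈ π.parts.attach, (1 : ℝ) = k + 1 := by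
        intro π hπ
        rw [Finset.sum_const, nsmul_one, Finset.card_attach, mem_kPartitions.1 hπ]
        push_cast; ring
      rw [Finset.sum_congr rfl h2] at h
      simp only [Finset.sum_const, nsmul_eq_mul, mul_one, ih] at h
      rw [Nat.stirlingSecond_succ_succ]
      have : ((kPartitions (n + 1) (k + 1)).card : ℝ) =
          (((k + 1) * n.stirlingSecond (k + 1) + n.stirlingSecond k : ℕ) : ℝ) := by
        rw [h]; push_cast; ring
      exact_mod_cast this

theorem stirlingSecond_succ_succ_cast (n k : ℕ) :
    ((n + 1).stirlingSecond (k + 1) : ℝ) =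
      (k + 1) * n.stirlingSecond (k + 1) + n.stirlingSecond k := by
  rw [Nat.stirlingSecond_succ_succ]; push_cast; ring

theorem cro_zero (π : SetPartition 0) : cro π = 0 := by
  rw [cro, Finset.card_eq_zero, Finset.eq_empty_iff_forall_notMem]
  intro c hc
  obtain ⟨⟨-, h⟩, -, -, h'⟩ := mem_crossings.1 hc
  have := snd_le_of_mem_edges h
  omega

theorem coverSum_zero (π : SetPartition 0) : coverSum π = 0 := by
  refine Finset.sum_eq_zero fun B hB => ?_
  rw [cover, Finset.card_eq_zero, Finset.filter_eq_empty_iff]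
  intro e he h
  have := snd_le_of_mem_edges he
  omega

theorem sum_coverSum_succ (n k : ℕ) :
    ∑ ρ ∈ kPartitions (n + 1) (k + 1), (coverSum ρ : ℝ) =
      ∑ π ∈ kPartitions n k, (coverSum π : ℝ) +
        k * ∑ π ∈ kPartitions n (k + 1), (coverSum π : ℝ) +
        (k + 1).choose 2 * n.stirlingSecond (k + 1) := by
  rw [sum_kPartitions_succ, add_assoc]
  refine congrArg₂ (· + ·) ?_ ?_
  · refine Finset.sum_congr rfl fun π _ => ?_
    have := coverSum_extend π ∅ (Finset.mem_insert_self _ _)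
    simp only [Finset.sup_empty, bot_eq_zero, cover_zero, Finset.not_nonempty_empty, if_false,
      add_zero] at this
    exact_mod_cast this
  · rw [← card_kPartitions, Finset.mul_sum, mul_comm _ (Finset.card _ : ℝ), ← nsmul_eq_mul,
      ← Finset.sum_const, ← Finset.sum_add_distrib]
    refine Finset.sum_congr rfl fun π hπ => ?_
    rw [sum_coverSum_extend, mem_kPartitions.1 hπ]
    push_cast; ring

theorem sum_cro_succ (n k : ℕ) :
    ∑ ρ ∈ kPartitions (n + 1) (k + 1), (cro ρ : ℝ) =
      ∑ π ∈ kPartitions n k, (cro π : ℝ) +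
        (k + 1) * ∑ π ∈ kPartitions n (k + 1), (cro π : ℝ) +
        ∑ π ∈ kPartitions n (k + 1), (coverSum π : ℝ) := by
  rw [sum_kPartitions_succ, add_assoc]
  refine congrArg₂ (· + ·) ?_ ?_
  · refine Finset.sum_congr rfl fun π _ => ?_
    rw [cro_extend, Finset.sup_empty, bot_eq_zero, cover_zero, add_zero]
  · rw [Finset.mul_sum, ← Finset.sum_add_distrib]
    refine Finset.sum_congr rfl fun π hπ => ?_
    rw [sum_cro_extend, mem_kPartitions.1 hπ]
    push_cast; ring

/-- The induction is driven by `sum_coverSum_succ`; the case `k = 0` is separate because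
`kPartitions (n + 1) 0` is empty, and the recursion does not apply to it. -/
theorem sum_coverSum_eq (n k : ℕ) :
    ∑ π ∈ kPartitions n (k + 1), (coverSum π : ℝ) =
      (k + 1) * k / 2 * n.stirlingSecond (k + 1) - (n - k) * n.stirlingSecond k := by
  induction n generalizing k with
  | zero =>
    cases k with
    | zero => simp [coverSum_zero]
    | succ k => simp [coverSum_zero]
  | succ n ih =>
    rw [sum_coverSum_succ, ih, Nat.cast_choose_two]
    cases k with
    | zero =>
      rw [stirlingSecond_succ_succ_cast]
      cases n with
      | zero =>
        simp [coverSum_zero]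
      | succ n =>
        simp [kPartitions_succ_zero]
    | succ k =>
      rw [ih, stirlingSecond_succ_succ_cast, stirlingSecond_succ_succ_cast]
      push_cast; ring

/-- Total number of crossings over the partitions of `[n]` into `k + 1` blocks. -/
theorem sum_cro_eq (n k : ℕ) :
    ∑ π ∈ kPartitions n (k + 1), (cro π : ℝ) =
      (1 / 2 * n * k - 5 / 4 * ((k + 1) * k)) * n.stirlingSecond (k + 1) +
        3 / 2 * (n - k) * n.stirlingSecond k := by
  induction n generalizing k with
  | zero =>
    cases k with
    | zero => simp [cro_zero]
    | succ k => simp [cro_zero]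
  | succ n ih =>
    rw [sum_cro_succ, ih, sum_coverSum_eq]
    cases k with
    | zero =>
      rw [stirlingSecond_succ_succ_cast]
      cases n with
      | zero => simp [cro_zero]
      | succ n => simp [kPartitions_succ_zero]
    | succ k =>
      rw [ih, stirlingSecond_succ_succ_cast, stirlingSecond_succ_succ_cast]
      push_cast; ring

/-! ### Summation over the number of blocks, and fixed numbers of blocks -/

theorem sum_choose_mul_stirlingSecond (n k : ℕ) :
    ∑ j ∈ Finset.range (n + 1), n.choose j * j.stirlingSecond k =
      (n + 1).stirlingSecond (k + 1) := by
  induction n generalizing k with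
  | zero => cases k <;> simp [Nat.stirlingSecond]
  | succ n ih =>
    have h := Finset.sum_choose_succ_mul (R := ℕ) (fun i _ => i.stirlingSecond k) n
    simp only [Nat.cast_id] at h
    rw [h, ih, Nat.stirlingSecond_succ_succ (n + 1) k]
    cases k with
    | zero => simp [Nat.stirlingSecond_succ_zero]
    | succ k =>
      simp only [Nat.stirlingSecond_succ_succ _ k, mul_add, Finset.sum_add_distrib, ih,
        mul_left_comm _ (k + 1), ← Finset.mul_sum]
      rw [← Nat.stirlingSecond_succ_succ]
      ring

theorem bell_succ_eq_sum_range (n : ℕ) :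
    (n + 1).bell = ∑ j ∈ Finset.range (n + 1), n.choose j * j.bell := by
  rw [Nat.bell_succ, ← Finset.sum_range_reflect]
  refine Finset.sum_congr (by ext; simp) fun i hi => ?_
  have := Finset.mem_range.1 hi
  rw [show n + 1 - 1 - i = n - i by omega, Nat.choose_symm (by omega)]

theorem sum_stirlingSecond (n : ℕ) :
    ∑ k ∈ Finset.range (n + 1), n.stirlingSecond k = n.bell := by
  induction n using Nat.strong_induction_on with
  | _ n ih =>
    cases n with
    | zero => simp
    | succ n =>
      rw [Finset.sum_range_succ', Nat.stirlingSecond_succ_zero, add_zero, bell_succ_eq_sum_range]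
      simp only [← sum_choose_mul_stirlingSecond]
      rw [Finset.sum_comm]
      refine Finset.sum_congr rfl fun j hj => ?_
      have hj' := Finset.mem_range.1 hj
      rw [← Finset.mul_sum, ← ih j hj']
      congr 1
      symm
      refine Finset.sum_subset (Finset.range_subset_range.2 (by omega)) fun k _ hk => ?_
      exact Nat.stirlingSecond_eq_zero_of_lt (by simpa [Nat.lt_succ_iff] using hk)

theorem sum_stirlingSecond_cast (n : ℕ) :
    ∑ k ∈ Finset.range (n + 1), (n.stirlingSecond k : ℝ) = n.bell := by
  rw [← sum_stirlingSecond]; push_cast; rfl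

/-- Summation against Stirling numbers turns `n + 1` into `n` at the cost of replacing the weight
`f` by `k * f k + f (k + 1)`. With `f = 1` and `f = id` this gives the first two moments. -/
theorem sum_mul_stirlingSecond_succ (n : ℕ) (f : ℕ → ℝ) :
    ∑ k ∈ Finset.range (n + 2), f k * (n + 1).stirlingSecond k =
      ∑ k ∈ Finset.range (n + 1), (k * f k + f (k + 1)) * n.stirlingSecond k := by
  have h1 : ∑ k ∈ Finset.range (n + 1), k * f k * (n.stirlingSecond k : ℝ) =
      ∑ k ∈ Finset.range (n + 1),
        (k + 1 : ℝ) * f (k + 1) * (n.stirlingSecond (k + 1) : ℝ) := by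
    have := Finset.sum_range_succ' (fun k : ℕ => k * f k * (n.stirlingSecond k : ℝ)) (n + 1)
    rw [Finset.sum_range_succ, Nat.stirlingSecond_eq_zero_of_lt (Nat.lt_succ_self n)] at this
    simpa using this
  simp only [add_mul, Finset.sum_add_distrib]
  rw [h1, Finset.sum_range_succ', Nat.stirlingSecond_succ_zero, Nat.cast_zero, mul_zero, add_zero,
    ← Finset.sum_add_distrib]
  refine Finset.sum_congr rfl fun k _ => ?_
  rw [stirlingSecond_succ_succ_cast]
  ring

theorem sum_natCast_mul_stirlingSecond (n : ℕ) :
    ∑ k ∈ Finset.range (n + 1), (k : ℝ) * n.stirlingSecond k = (n + 1).bell - n.bell := by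
  have h := sum_mul_stirlingSecond_succ n fun _ => 1
  simp only [one_mul, mul_one, sum_stirlingSecond_cast (n + 1), add_mul, Finset.sum_add_distrib,
    sum_stirlingSecond_cast n] at h
  linarith

theorem sum_sq_mul_stirlingSecond (n : ℕ) :
    ∑ k ∈ Finset.range (n + 1), (k : ℝ) ^ 2 * n.stirlingSecond k =
      (n + 2).bell - 2 * (n + 1).bell := by
  have h := sum_mul_stirlingSecond_succ n fun k => k
  simp only [sum_natCast_mul_stirlingSecond (n + 1), Nat.cast_add, Nat.cast_one, add_mul,
    Finset.sum_add_distrib, sum_stirlingSecond_cast n, sum_natCast_mul_stirlingSecond n, one_mul,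
    ← pow_two] at h
  linarith

theorem bell_pos (n : ℕ) : 0 < n.bell := by
  rw [← sum_stirlingSecond]
  exact (Nat.stirlingSecond_self n ▸ Nat.one_pos).trans_le
    (Finset.single_le_sum (f := fun k => n.stirlingSecond k) (fun _ _ => Nat.zero_le _)
      (Finset.self_mem_range_succ n))

theorem sum_setPartition (n : ℕ) (f : SetPartition n → ℝ) :
    ∑ π, f π = ∑ k ∈ Finset.range (n + 1), ∑ π ∈ kPartitions n k, f π := by
  rw [← Finset.sum_fiberwise_of_maps_to (g := fun π : SetPartition n => π.parts.card)
    (t := Finset.range (n + 1))]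
  · rfl
  · exact fun π _ => Finset.mem_range.2 (Nat.lt_succ_of_le (card_parts_le π))

theorem card_setPartition (n : ℕ) : Fintype.card (SetPartition n) = n.bell := by
  have h := sum_setPartition n fun _ => 1
  simp only [Finset.sum_const, nsmul_eq_mul, mul_one, card_kPartitions, sum_stirlingSecond_cast,
    Finset.card_univ] at h
  exact_mod_cast h

theorem sum_cro_kPartitions_zero (n : ℕ) : ∑ π ∈ kPartitions n 0, (cro π : ℝ) = 0 := by
  cases n with
  | zero => simp [cro_zero]
  | succ n => simp [kPartitions_succ_zero]

theorem sum_cro (n : ℕ) :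
    ∑ π : SetPartition n, (cro π : ℝ) =
      -(5 / 4) * (n + 2).bell + (n / 2 + 9 / 4) * (n + 1).bell + (n / 2 + 1 / 4) * n.bell := by
  -- summing over one more value of `k` is harmless and makes the two shifted sums match
  have hlast : ∑ π ∈ kPartitions n (n + 1), (cro π : ℝ) = 0 := by
    rw [Finset.card_eq_zero.1 ((card_kPartitions n (n + 1)).trans
      (Nat.stirlingSecond_eq_zero_of_lt (Nat.lt_succ_self n))), Finset.sum_empty]
  have h0 : ∑ π : SetPartition n, (cro π : ℝ) =
      ∑ k ∈ Finset.range (n + 1), ∑ π ∈ kPartitions n (k + 1), (cro π : ℝ) := by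
    have := Finset.sum_range_succ' (fun k => ∑ π ∈ kPartitions n k, (cro π : ℝ)) (n + 1)
    rw [Finset.sum_range_succ, hlast, sum_cro_kPartitions_zero, add_zero, add_zero] at this
    rw [sum_setPartition, this]
  have h1 : ∑ k ∈ Finset.range (n + 1),
        (1 / 2 * n * k - 5 / 4 * ((k + 1) * k)) * (n.stirlingSecond (k + 1) : ℝ) =
      ∑ k ∈ Finset.range (n + 1),
        (1 / 2 * n * (k - 1) - 5 / 4 * (k * (k - 1))) * (n.stirlingSecond k : ℝ) +
        1 / 2 * n * n.stirlingSecond 0 := by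
    have := Finset.sum_range_succ' (fun k : ℕ =>
      (1 / 2 * n * (k - 1) - 5 / 4 * (k * (k - 1))) * (n.stirlingSecond k : ℝ)) (n + 1)
    rw [Finset.sum_range_succ, Nat.stirlingSecond_eq_zero_of_lt (Nat.lt_succ_self n)] at this
    push_cast at this
    simp only [add_sub_cancel_right, mul_zero, add_zero, zero_mul] at this
    rw [this]
    ring
  have h2 : (n : ℝ) * n.stirlingSecond 0 = 0 := by cases n <;> simp
  simp only [h0, sum_cro_eq, Finset.sum_add_distrib, h1]
  have h3 : ∀ k : ℕ, (1 / 2 * n * (k - 1) - 5 / 4 * (k * (k - 1))) * (n.stirlingSecond k : ℝ) +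
      3 / 2 * (n - k) * n.stirlingSecond k =
      n * n.stirlingSecond k + (1 / 2 * n - 1 / 4) * (k * n.stirlingSecond k) -
        5 / 4 * (k ^ 2 * n.stirlingSecond k) := fun k => by ring
  have h4 := Finset.sum_congr (rfl : Finset.range (n + 1) = _) fun k _ => h3 k
  simp only [Finset.sum_add_distrib, Finset.sum_sub_distrib, ← Finset.mul_sum,
    sum_stirlingSecond_cast, sum_natCast_mul_stirlingSecond, sum_sq_mul_stirlingSecond] at h4
  linear_combination h4 + 1 / 2 * h2

theorem meanCro_eq (n : ℕ) :
    meanCro n =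
      -(5 / 4 : ℝ) * ((Nat.bell (n + 2) : ℝ) / (Nat.bell n : ℝ))
        + ((n : ℝ) / 2 + 9 / 4) * ((Nat.bell (n + 1) : ℝ) / (Nat.bell n : ℝ))
        + (n : ℝ) / 2 + 1 / 4 := by
  have h : (n.bell : ℝ) ≠ 0 := Nat.cast_ne_zero.2 (bell_pos n).ne'
  rw [meanCro, sum_cro, card_setPartition]
  field_simp
  ring

theorem pow_le_stirlingSecond (n k : ℕ) : (k + 1) ^ n ≤ (n + (k + 1)).stirlingSecond (k + 1) := by
  induction n with
  | zero => simp [Nat.stirlingSecond_self]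
  | succ n ih =>
    rw [show n + 1 + (k + 1) = (n + (k + 1)) + 1 by ring, Nat.stirlingSecond_succ_succ, pow_succ']
    exact (Nat.mul_le_mul_left _ ih).trans (Nat.le_add_right _ _)

theorem stirlingSecond_pos {n k : ℕ} (hk : 1 ≤ k) (h : k ≤ n) : 0 < n.stirlingSecond k := by
  obtain ⟨k, rfl⟩ := Nat.exists_eq_add_of_le' hk
  obtain ⟨n, rfl⟩ := Nat.exists_eq_add_of_le' h
  exact (pow_pos k.succ_pos n).trans_le (pow_le_stirlingSecond n k)

theorem meanCroBlocks_eq {n k : ℕ} (hk : 1 ≤ k) (h : k ≤ n) :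
    meanCroBlocks n k =
      (1 / 2 : ℝ) * n * ((k : ℝ) - 1) - (5 / 2 : ℝ) * (Nat.choose k 2 : ℝ)
        + (3 / 2 : ℝ) * ((n : ℝ) + 1 - k) *
          ((Nat.stirlingSecond n (k - 1) : ℝ) / (Nat.stirlingSecond n k : ℝ)) := by
  have hS : (n.stirlingSecond k : ℝ) ≠ 0 := Nat.cast_ne_zero.2 (stirlingSecond_pos hk h).ne'
  obtain ⟨k, rfl⟩ := Nat.exists_eq_add_of_le' hk
  rw [meanCroBlocks, sum_cro_eq, card_kPartitions, Nat.cast_choose_two, Nat.add_sub_cancel]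
  push_cast
  field_simp
  ring

theorem stirlingSecond_le (n k : ℕ) : n.stirlingSecond k ≤ (n + 1) ^ k * k ^ n := by
  induction n generalizing k with
  | zero => cases k <;> simp [Nat.stirlingSecond]
  | succ n ih =>
    cases k with
    | zero => simp
    | succ k =>
      rw [Nat.stirlingSecond_succ_succ]
      calc (k + 1) * n.stirlingSecond (k + 1) + n.stirlingSecond k
          ≤ (k + 1) * ((n + 1) ^ (k + 1) * (k + 1) ^ n) + (n + 1) ^ k * (k + 1) ^ n := by
            gcongr
            · exact ih _
            · exact (ih k).trans (by gcongr; omega)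
        _ ≤ (k + 1) * ((n + 1) ^ (k + 1) * (k + 1) ^ n) +
              (n + 1) ^ k * ((k + 1) * (k + 1) ^ n) := by
            gcongr
            exact Nat.le_mul_of_pos_left _ k.succ_pos
        _ = (n + 1) ^ k * (n + 2) * (k + 1) ^ (n + 1) := by ring
        _ ≤ (n + 2) ^ k * (n + 2) * (k + 1) ^ (n + 1) := by gcongr; omega
        _ = (n + 1 + 1) ^ (k + 1) * (k + 1) ^ (n + 1) := by ring

theorem tendsto_mul_stirlingSecond_ratio (k : ℕ) (hk : 1 ≤ k) :
    Tendsto (fun n : ℕ => ((n : ℝ) + 1 - k) *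
      ((n.stirlingSecond (k - 1) : ℝ) / (n.stirlingSecond k : ℝ))) atTop (𝓝 0) := by
  obtain ⟨k, rfl⟩ := Nat.exists_eq_add_of_le' hk
  rw [Nat.add_sub_cancel]
  -- the ratio of Stirling numbers decays like `r ^ n` up to a power of `n`
  set r : ℝ := k / (k + 1)
  have hr0 : 0 ≤ r := by positivity
  have hr1 : r < 1 := (div_lt_one (by positivity)).2 (by linarith)
  have hlim : Tendsto (fun n : ℕ => (2 * (k + 1) : ℝ) ^ (k + 1) * ((n : ℝ) ^ (k + 1) * r ^ n))
      atTop (𝓝 0) := by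
    simpa using (tendsto_pow_const_mul_const_pow_of_abs_lt_one (k + 1)
      (by rwa [abs_of_nonneg hr0])).const_mul ((2 * (k + 1) : ℝ) ^ (k + 1))
  refine squeeze_zero' ?_ ?_ hlim
  · filter_upwards [eventually_ge_atTop (k + 1)] with n hn
    have : ((k + 1 : ℕ) : ℝ) ≤ n := by exact_mod_cast hn
    have : 0 ≤ (n : ℝ) + 1 - (k + 1 : ℕ) := by linarith
    positivity
  · filter_upwards [eventually_ge_atTop (k + 1)] with n hn
    obtain ⟨m, rfl⟩ := Nat.exists_eq_add_of_le' hn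
    have h1 : ((k + 1 : ℝ)) ^ m ≤ (m + (k + 1)).stirlingSecond (k + 1) := by
      exact_mod_cast pow_le_stirlingSecond m k
    have h2 : ((m + (k + 1)).stirlingSecond k : ℝ) ≤
        (((m + (k + 1) : ℕ) : ℝ) + 1) ^ k * (k : ℝ) ^ (m + (k + 1)) := by
      exact_mod_cast stirlingSecond_le (m + (k + 1)) k
    have hN : (1 : ℝ) ≤ ((m + (k + 1) : ℕ) : ℝ) := by
      exact_mod_cast (by omega : 1 ≤ m + (k + 1))
    have hk1 : ((k + 1 : ℕ) : ℝ) ≤ ((m + (k + 1) : ℕ) : ℝ) := by exact_mod_cast hn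
    have hk0 : (1 : ℝ) ≤ ((k + 1 : ℕ) : ℝ) := by exact_mod_cast hk
    generalize hNd : m + (k + 1) = N at *
    calc ((N : ℝ) + 1 - (k + 1 : ℕ)) *
          ((N.stirlingSecond k : ℝ) / (N.stirlingSecond (k + 1) : ℝ))
        ≤ (2 * N) * (((2 * N) ^ k * (k : ℝ) ^ N) / (k + 1 : ℝ) ^ m) := by
          gcongr
          · linarith
          · exact h2.trans (by gcongr; linarith)
      _ = (2 * (k + 1) : ℝ) ^ (k + 1) * ((N : ℝ) ^ (k + 1) * r ^ N) := by
          rw [mul_pow 2 (k + 1 : ℝ), div_pow, ← hNd, pow_add (k + 1 : ℝ) m (k + 1), hNd]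
          field_simp
          ring

theorem tendsto_meanCroBlocks (k : ℕ) (hk : 1 ≤ k) :
    Tendsto
      (fun n : ℕ => meanCroBlocks n k -
        ((1 / 2 : ℝ) * n * ((k : ℝ) - 1) - (5 / 2 : ℝ) * (Nat.choose k 2 : ℝ)))
      atTop (𝓝 0) := by
  have h := (tendsto_mul_stirlingSecond_ratio k hk).const_mul (3 / 2)
  rw [mul_zero] at h
  refine h.congr' ?_
  filter_upwards [eventually_ge_atTop k] with n hn
  rw [meanCroBlocks_eq hk hn]
  ring

/-! ### Ratios of consecutive Bell numbers -/

/-- Index shift for a series whose term of index `0` vanishes. -/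
theorem hasSum_succ_iff_of_zero {f : ℕ → ℝ} (h0 : f 0 = 0) {a : ℝ} :
    HasSum f a ↔ HasSum (fun m => f (m + 1)) a := by
  rw [← hasSum_nat_add_iff' 1]
  simp [h0]

/-- Dobiński's formula. -/
theorem hasSum_pow_div_factorial (n : ℕ) :
    HasSum (fun m : ℕ => (m : ℝ) ^ n / (m.factorial : ℝ)) (Real.exp 1 * n.bell) := by
  induction n using Nat.strong_induction_on with
  | _ n ih =>
    cases n with
    | zero =>
      have h := NormedSpace.expSeries_div_hasSum_exp (𝔸 := ℝ) 1
      rw [← Real.exp_eq_exp_ℝ] at h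
      simpa using h
    | succ n =>
      rw [hasSum_succ_iff_of_zero (by simp)]
      have h : HasSum (fun m : ℕ => ∑ j ∈ Finset.range (n + 1),
          (n.choose j : ℝ) * ((m : ℝ) ^ j / (m.factorial : ℝ)))
          (∑ j ∈ Finset.range (n + 1), (n.choose j : ℝ) * (Real.exp 1 * j.bell)) :=
        hasSum_sum fun j hj => (ih j (Finset.mem_range.1 hj)).mul_left _
      convert h using 1
      · funext m
        rw [Nat.factorial_succ]
        push_cast
        rw [pow_succ, mul_comm ((m : ℝ) + 1) (m.factorial : ℝ),
          mul_div_mul_right _ _ (by positivity : (m : ℝ) + 1 ≠ 0), add_pow, Finset.sum_div]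
        exact Finset.sum_congr rfl fun j _ => by rw [one_pow]; ring
      · rw [bell_succ_eq_sum_range]
        push_cast
        rw [Finset.mul_sum]
        exact Finset.sum_congr rfl fun j _ => by ring

theorem hasSum_add_one_pow_div_factorial (n : ℕ) :
    HasSum (fun m : ℕ => ((m : ℝ) + 1) ^ n / (m.factorial : ℝ)) (Real.exp 1 * (n + 1).bell) := by
  have h := (hasSum_succ_iff_of_zero (by simp)).1 (hasSum_pow_div_factorial (n + 1))
  convert h using 2 with m
  rw [Nat.factorial_succ]
  push_cast
  rw [pow_succ, mul_comm ((m : ℝ) + 1) (m.factorial : ℝ),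
    mul_div_mul_right _ _ (by positivity : (m : ℝ) + 1 ≠ 0)]

theorem hasSum_mul_sub_one_pow_div_factorial (n : ℕ) :
    HasSum (fun m : ℕ => (m : ℝ) * ((m : ℝ) - 1) ^ n / (m.factorial : ℝ))
      (Real.exp 1 * n.bell) := by
  rw [hasSum_succ_iff_of_zero (by simp)]
  convert hasSum_pow_div_factorial n using 2 with m
  rw [Nat.factorial_succ]
  push_cast
  rw [add_sub_cancel_right, mul_div_mul_left _ _ (by positivity : (m : ℝ) + 1 ≠ 0)]

/-- The power function lies above its tangent line at `b` (Bernoulli's inequality). -/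
theorem pow_tangent_le {x b : ℝ} (hx : 0 ≤ x) (hb : 0 < b) (n : ℕ) :
    b ^ n * (1 + n * (x / b - 1)) ≤ x ^ n := by
  have h := one_add_mul_sub_le_pow (a := x / b) (by linarith [div_nonneg hx hb.le]) n
  rw [div_pow, le_div_iff₀ (pow_pos hb n)] at h
  linarith

/-- The ratio `B_{n+1} / B_n` of consecutive Bell numbers. -/
noncomputable def bellRatio (n : ℕ) : ℝ := ((n + 1).bell : ℝ) / (n.bell : ℝ)

theorem bellRatio_pos (n : ℕ) : 0 < bellRatio n :=
  div_pos (Nat.cast_pos.2 (bell_pos _)) (Nat.cast_pos.2 (bell_pos _))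

/-- Jensen's inequality for `y ↦ (1 + y) ^ n`, under the weights `m ^ n / m!` and with `y = 1 / m`.
These weights have total mass `e * B_n`, and the integral of `(1 + 1 / m) ^ n` is at most
`e * B_{n+1}`. The tangent line is taken at the inverse of the mean `B_{n+1} / B_n` of `m`. -/
theorem one_add_inv_pow_le_bellRatio (n : ℕ) : (1 + (bellRatio n)⁻¹) ^ n ≤ bellRatio n := by
  have hR := bellRatio_pos n
  have hB : (0 : ℝ) < n.bell := Nat.cast_pos.2 (bell_pos n)
  set a := (bellRatio n)⁻¹ with ha
  have ha0 : 0 < a := inv_pos.2 hR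
  have hb0 : 0 < 1 + a := by linarith
  have haB : a * (n + 1).bell = n.bell := by
    rw [ha, bellRatio, inv_div, div_mul_cancel₀]
    exact Nat.cast_ne_zero.2 (bell_pos _).ne'
  have hterm : ∀ m : ℕ, (1 + a) ^ n * ((m : ℝ) ^ n / (m.factorial : ℝ)) +
      (1 + a) ^ n * n / (1 + a) * (a * ((m : ℝ) ^ n / (m.factorial : ℝ)) -
        a ^ 2 * ((m : ℝ) ^ (n + 1) / (m.factorial : ℝ))) ≤
      ((m : ℝ) + 1) ^ n / (m.factorial : ℝ) := by
    intro m
    have hmf : (0 : ℝ) < m.factorial := Nat.cast_pos.2 m.factorial_pos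
    have key : (1 + a) ^ n * ((m : ℝ) ^ n) +
        (1 + a) ^ n * n / (1 + a) * (a * (m : ℝ) ^ n - a ^ 2 * (m : ℝ) ^ (n + 1)) ≤
        ((m : ℝ) + 1) ^ n := by
      rcases Nat.eq_zero_or_pos m with rfl | hm
      · cases n <;> simp
      · have hm' : (0 : ℝ) < m := Nat.cast_pos.2 hm
        have h1 := pow_tangent_le (x := 1 + (m : ℝ)⁻¹) (by positivity) hb0 n
        -- `1 / m ≥ 2 a - a² m`
        have h2 : a - a ^ 2 * m ≤ (m : ℝ)⁻¹ - a := by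
          have : (m : ℝ)⁻¹ - a - (a - a ^ 2 * m) = (m : ℝ)⁻¹ * (1 - a * m) ^ 2 := by
            field_simp
          have : 0 ≤ (m : ℝ)⁻¹ * (1 - a * m) ^ 2 := by positivity
          linarith
        have h3 : (a - a ^ 2 * m) / (1 + a) ≤ (1 + (m : ℝ)⁻¹) / (1 + a) - 1 := by
          rw [div_sub_one hb0.ne']
          exact div_le_div_of_nonneg_right (by linarith) hb0.le
        calc (1 + a) ^ n * ((m : ℝ) ^ n) +
              (1 + a) ^ n * n / (1 + a) * (a * (m : ℝ) ^ n - a ^ 2 * (m : ℝ) ^ (n + 1))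
            = (m : ℝ) ^ n * ((1 + a) ^ n * (1 + n * ((a - a ^ 2 * m) / (1 + a)))) := by
              field_simp
              ring
          _ ≤ (m : ℝ) ^ n * ((1 + a) ^ n * (1 + n * ((1 + (m : ℝ)⁻¹) / (1 + a) - 1))) := by
              gcongr
          _ ≤ (m : ℝ) ^ n * (1 + (m : ℝ)⁻¹) ^ n := by gcongr
          _ = ((m : ℝ) + 1) ^ n := by
              rw [← mul_pow]
              congr 1
              field_simp
    calc _ = ((1 + a) ^ n * ((m : ℝ) ^ n) +
        (1 + a) ^ n * n / (1 + a) * (a * (m : ℝ) ^ n - a ^ 2 * (m : ℝ) ^ (n + 1))) /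
          (m.factorial : ℝ) := by ring
      _ ≤ _ := by gcongr
  have h := hasSum_le hterm
    (((hasSum_pow_div_factorial n).mul_left _).add
      ((((hasSum_pow_div_factorial n).mul_left a).sub
        ((hasSum_pow_div_factorial (n + 1)).mul_left (a ^ 2))).mul_left _))
    (hasSum_add_one_pow_div_factorial n)
  have h0 : a * (Real.exp 1 * n.bell) - a ^ 2 * (Real.exp 1 * (n + 1).bell) = 0 := by
    linear_combination -a * Real.exp 1 * haB
  rw [h0, mul_zero, add_zero, mul_left_comm] at h
  rw [bellRatio, le_div_iff₀ hB]
  exact le_of_mul_le_mul_left h (Real.exp_pos 1)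

/-- Jensen's inequality for `y ↦ (1 - y) ^ n`, under the weights `m ^ (n + 1) / m!` and with
`y = 1 / m`, whose mean is `B_n / B_{n+1}`. The integral of `(1 - 1 / m) ^ n` is `e * B_n`. -/
theorem one_sub_inv_pow_le_inv_bellRatio {n : ℕ} (h1 : 1 < bellRatio n) :
    (1 - (bellRatio n)⁻¹) ^ n ≤ (bellRatio n)⁻¹ := by
  have hB : (0 : ℝ) < (n + 1).bell := Nat.cast_pos.2 (bell_pos _)
  have hb0 : 0 < 1 - (bellRatio n)⁻¹ := sub_pos.2 (inv_lt_one_of_one_lt₀ h1)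
  set a := (bellRatio n)⁻¹ with ha
  have haB : a * (n + 1).bell = n.bell := by
    rw [ha, bellRatio, inv_div, div_mul_cancel₀ _ hB.ne']
  have hterm : ∀ m : ℕ, (1 - a) ^ n * ((m : ℝ) ^ (n + 1) / (m.factorial : ℝ)) +
      (1 - a) ^ n * n / (1 - a) * (a * ((m : ℝ) ^ (n + 1) / (m.factorial : ℝ)) -
        (m : ℝ) ^ n / (m.factorial : ℝ)) ≤
      (m : ℝ) * ((m : ℝ) - 1) ^ n / (m.factorial : ℝ) := by
    intro m
    have hmf : (0 : ℝ) < m.factorial := Nat.cast_pos.2 m.factorial_pos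
    have key : (1 - a) ^ n * ((m : ℝ) ^ (n + 1)) +
        (1 - a) ^ n * n / (1 - a) * (a * (m : ℝ) ^ (n + 1) - (m : ℝ) ^ n) ≤
        (m : ℝ) * ((m : ℝ) - 1) ^ n := by
      rcases Nat.eq_zero_or_pos m with rfl | hm
      · cases n <;> simp
      · have hm' : (1 : ℝ) ≤ m := Nat.one_le_cast.2 hm
        have hm0 : (0 : ℝ) < m := by linarith
        have h1 := pow_tangent_le (x := 1 - (m : ℝ)⁻¹)
          (sub_nonneg.2 (inv_le_one_of_one_le₀ hm')) hb0 n
        calc (1 - a) ^ n * ((m : ℝ) ^ (n + 1)) +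
              (1 - a) ^ n * n / (1 - a) * (a * (m : ℝ) ^ (n + 1) - (m : ℝ) ^ n)
            = (m : ℝ) ^ (n + 1) *
                ((1 - a) ^ n * (1 + n * ((1 - (m : ℝ)⁻¹) / (1 - a) - 1))) := by
              have := hb0.ne'
              field_simp
              ring
          _ ≤ (m : ℝ) ^ (n + 1) * (1 - (m : ℝ)⁻¹) ^ n := by gcongr
          _ = (m : ℝ) * ((m : ℝ) - 1) ^ n := by
              rw [pow_succ', mul_assoc, ← mul_pow, mul_sub, mul_one, mul_inv_cancel₀ hm0.ne']
    calc _ = ((1 - a) ^ n * ((m : ℝ) ^ (n + 1)) +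
        (1 - a) ^ n * n / (1 - a) * (a * (m : ℝ) ^ (n + 1) - (m : ℝ) ^ n)) /
          (m.factorial : ℝ) := by ring
      _ ≤ _ := by gcongr
  have h := hasSum_le hterm
    (((hasSum_pow_div_factorial (n + 1)).mul_left _).add
      ((((hasSum_pow_div_factorial (n + 1)).mul_left a).sub
        (hasSum_pow_div_factorial n)).mul_left _))
    (hasSum_mul_sub_one_pow_div_factorial n)
  have h0 : a * (Real.exp 1 * (n + 1).bell) - Real.exp 1 * n.bell = 0 := by
    linear_combination Real.exp 1 * haB
  rw [h0, mul_zero, add_zero, mul_left_comm, ← haB] at h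
  exact le_of_mul_le_mul_right (le_of_mul_le_mul_left h (Real.exp_pos 1)) hB

theorem le_bellRatio_add_one_mul_log (n : ℕ) :
    (n : ℝ) ≤ (bellRatio n + 1) * Real.log (bellRatio n) := by
  have hR := bellRatio_pos n
  have h := Real.log_le_log (by positivity) (one_add_inv_pow_le_bellRatio n)
  rw [Real.log_pow] at h
  have h2 := Real.one_sub_inv_le_log_of_pos (x := 1 + (bellRatio n)⁻¹) (by positivity)
  have h3 : 1 - (1 + (bellRatio n)⁻¹)⁻¹ = (bellRatio n + 1)⁻¹ := by
    field_simp
    ring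
  rw [h3] at h2
  have h4 : (n : ℝ) * (bellRatio n + 1)⁻¹ ≤ Real.log (bellRatio n) :=
    (mul_le_mul_of_nonneg_left h2 n.cast_nonneg).trans h
  rw [← div_eq_mul_inv, div_le_iff₀ (by positivity)] at h4
  linarith

theorem bellRatio_sub_one_mul_log_le {n : ℕ} (h1 : 1 < bellRatio n) :
    (bellRatio n - 1) * Real.log (bellRatio n) ≤ n := by
  have hR := bellRatio_pos n
  have hb0 : 0 < 1 - (bellRatio n)⁻¹ := sub_pos.2 (inv_lt_one_of_one_lt₀ h1)
  have h := Real.log_le_log (by positivity) (one_sub_inv_pow_le_inv_bellRatio h1)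
  rw [Real.log_pow, Real.log_inv] at h
  have h2 := Real.one_sub_inv_le_log_of_pos hb0
  have h3 : 1 - (1 - (bellRatio n)⁻¹)⁻¹ = -(bellRatio n - 1)⁻¹ := by
    have : bellRatio n - 1 ≠ 0 := by linarith
    have := hb0.ne'
    field_simp
    ring
  rw [h3] at h2
  have h4 : Real.log (bellRatio n) ≤ n * (bellRatio n - 1)⁻¹ := by
    have := mul_le_mul_of_nonneg_left h2 (n.cast_nonneg (α := ℝ))
    linarith
  rw [← div_eq_mul_inv, le_div_iff₀ (by linarith)] at h4
  linarith

theorem tendsto_bellRatio : Tendsto bellRatio atTop atTop := by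
  rw [tendsto_atTop]
  intro M
  filter_upwards [eventually_ge_atTop ⌈(M + 1) * M⌉₊] with n hn
  by_contra! hlt
  have hR := bellRatio_pos n
  have h1 := le_bellRatio_add_one_mul_log n
  have h2 : Real.log (bellRatio n) ≤ bellRatio n := Real.log_le_self hR.le
  have h3 : (M + 1) * M ≤ n := Nat.ceil_le.1 hn
  nlinarith

/-! ### Asymptotics of the mean -/

theorem tendsto_log_natCast : Tendsto (fun n : ℕ => Real.log n) atTop atTop :=
  Real.tendsto_log_atTop.comp tendsto_natCast_atTop_atTop

theorem tendsto_log_log_natCast : Tendsto (fun n : ℕ => Real.log (Real.log n)) atTop atTop :=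
  Real.tendsto_log_atTop.comp tendsto_log_natCast

/-- A sequence `R` with `R log R = n + O(log R)` satisfies
`R = n / log n * (1 + log log n / log n * (1 + o(1)))`. -/
theorem tendsto_of_mul_log_bounds {R : ℕ → ℝ} (hR : Tendsto R atTop atTop)
    (hlow : ∀ᶠ n : ℕ in atTop, (n : ℝ) ≤ (R n + 1) * Real.log (R n))
    (hupp : ∀ᶠ n : ℕ in atTop, (R n - 1) * Real.log (R n) ≤ n) :
    Tendsto (fun n : ℕ => (R n * Real.log n / n - 1) * (Real.log n / Real.log (Real.log n)))
      atTop (𝓝 1) := by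
  have hL : Tendsto (fun n => Real.log (R n)) atTop atTop := Real.tendsto_log_atTop.comp hR
  have hLL : Tendsto (fun n => Real.log (Real.log (R n))) atTop atTop :=
    Real.tendsto_log_atTop.comp hL
  have hRinv : Tendsto (fun n => (R n)⁻¹) atTop (𝓝 0) := tendsto_inv_atTop_zero.comp hR
  have hid : ∀ u : ℕ → ℝ, Tendsto u atTop atTop →
      Tendsto (fun n => Real.log (u n) / u n) atTop (𝓝 0) := fun u hu =>
    (Real.isLittleO_log_id_atTop.tendsto_div_nhds_zero).comp hu
  -- `q` measures the failure of `R log R = n`; it is within `1 / R` of `1`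
  set q : ℕ → ℝ := fun n => n / (R n * Real.log (R n)) with hq
  have hq1 : ∀ᶠ n in atTop, |q n - 1| ≤ (R n)⁻¹ := by
    filter_upwards [hlow, hupp, hR.eventually_gt_atTop 0, hL.eventually_gt_atTop 0]
      with n h1 h2 h3 h4
    have h5 : q n - 1 = (n - R n * Real.log (R n)) / (R n * Real.log (R n)) := by
      simp only [hq]; field_simp
    rw [h5, abs_div, abs_of_pos (mul_pos h3 h4), div_le_iff₀ (mul_pos h3 h4),
      inv_mul_cancel_left₀ h3.ne', abs_le]
    constructor <;> linarith
  have hq0 : Tendsto (fun n => q n - 1) atTop (𝓝 0) := squeeze_zero_norm' hq1 hRinv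
  have hqt : Tendsto q atTop (𝓝 1) := by simpa using hq0.add_const 1
  have hlogq : Tendsto (fun n => Real.log (q n)) atTop (𝓝 0) := by
    simpa using hqt.log one_ne_zero
  have hLq : Tendsto (fun n => Real.log (R n) * (1 - q n)) atTop (𝓝 0) := by
    refine squeeze_zero_norm' ?_ (hid R hR)
    filter_upwards [hq1, hL.eventually_gt_atTop 0] with n h1 h2
    rw [Real.norm_eq_abs, abs_mul, abs_of_pos h2, abs_sub_comm, div_eq_mul_inv]
    exact mul_le_mul_of_nonneg_left h1 h2.le
  -- from `n = q R log R`
  have hlogn : ∀ᶠ n : ℕ in atTop,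
      Real.log n = Real.log (q n) + Real.log (R n) + Real.log (Real.log (R n)) := by
    filter_upwards [hqt.eventually_ne one_ne_zero, hR.eventually_gt_atTop 0,
      hL.eventually_gt_atTop 0] with n h1 h2 h3
    rw [← Real.log_mul h1 h2.ne', ← Real.log_mul (mul_ne_zero h1 h2.ne') h3.ne']
    congr 1
    simp only [hq]
    field_simp
  have hratio : Tendsto (fun n : ℕ => Real.log n / Real.log (R n)) atTop (𝓝 1) := by
    have h := ((hlogq.mul (tendsto_inv_atTop_zero.comp hL)).add_const 1).add (hid _ hL)
    simp only [mul_zero, zero_add, add_zero] at h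
    refine h.congr' ?_
    filter_upwards [hlogn, hL.eventually_gt_atTop 0] with n h1 h2
    rw [h1, Function.comp_apply]
    field_simp
  have hllratio : Tendsto (fun n : ℕ => Real.log (Real.log (R n)) / Real.log (Real.log n)) atTop
      (𝓝 1) := by
    have h0 : Tendsto (fun n : ℕ => Real.log (Real.log n / Real.log (R n))) atTop (𝓝 0) := by
      simpa using hratio.log one_ne_zero
    have h := (h0.mul (tendsto_inv_atTop_zero.comp tendsto_log_log_natCast)).const_sub 1
    simp only [mul_zero, sub_zero] at h
    refine h.congr' ?_
    filter_upwards [tendsto_log_log_natCast.eventually_gt_atTop 0,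
      tendsto_log_natCast.eventually_gt_atTop 0, hL.eventually_gt_atTop 0] with n h1 h2 h3
    rw [Real.log_div h2.ne' h3.ne', Function.comp_apply]
    field_simp
    ring
  -- with `L = log R`, the quantity is
  -- `(log n / L) q⁻¹ ((log q + log L + L (1 - q)) / log log n)`
  have hinv := tendsto_inv_atTop_zero.comp tendsto_log_log_natCast
  have h := (hratio.mul (hqt.inv₀ one_ne_zero)).mul
    (((hlogq.mul hinv).add hllratio).add (hLq.mul hinv))
  simp only [inv_one, mul_zero, zero_add, add_zero, mul_one] at h
  refine h.congr' ?_
  filter_upwards [hlogn, hqt.eventually_ne one_ne_zero, hR.eventually_gt_atTop 0,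
    hL.eventually_gt_atTop 0, tendsto_log_log_natCast.eventually_gt_atTop 0,
    eventually_gt_atTop 0] with n h1 h2 h3 h4 h5 h6
  have h6' : (0 : ℝ) < n := Nat.cast_pos.2 h6
  have h7 : R n * Real.log n / n = Real.log n / (Real.log (R n) * q n) := by
    simp only [hq]; field_simp
  have h8 : Real.log n / (Real.log (R n) * q n) - 1 =
      (Real.log (q n) + Real.log (Real.log (R n)) + Real.log (R n) * (1 - q n)) /
        (Real.log (R n) * q n) := by
    rw [div_sub_one (mul_ne_zero h4.ne' h2)]
    congr 1
    rw [h1]; ring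
  rw [h7, h8, Function.comp_apply]
  field_simp

/-- Equivalently `B_{n+1} / B_n = n / log n * (1 + log log n / log n * (1 + o(1)))`. -/
theorem tendsto_bellRatio_expansion :
    Tendsto (fun n : ℕ =>
      (bellRatio n * Real.log n / n - 1) * (Real.log n / Real.log (Real.log n))) atTop (𝓝 1) :=
  tendsto_of_mul_log_bounds tendsto_bellRatio (Eventually.of_forall le_bellRatio_add_one_mul_log)
    ((tendsto_bellRatio.eventually_gt_atTop 1).mono fun _ => bellRatio_sub_one_mul_log_le)

theorem tendsto_bellRatio_mul_log_div :
    Tendsto (fun n : ℕ => bellRatio n * Real.log n / n) atTop (𝓝 1) := by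
  have h0 : Tendsto (fun n : ℕ => Real.log (Real.log n) / Real.log n) atTop (𝓝 0) :=
    (Real.isLittleO_log_id_atTop.tendsto_div_nhds_zero).comp tendsto_log_natCast
  have h := (tendsto_bellRatio_expansion.mul h0).add_const 1
  rw [mul_zero, zero_add] at h
  refine h.congr' ?_
  filter_upwards [tendsto_log_natCast.eventually_gt_atTop 0,
    tendsto_log_log_natCast.eventually_gt_atTop 0] with n h1 h2
  field_simp
  ring

/-- The quadratic term of the mean is `O(n² / log² n)`, hence negligible against
`n² log log n / log² n`. -/
theorem tendsto_bellRatio_mul_bellRatio_succ :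
    Tendsto (fun n : ℕ => (bellRatio n * Real.log n / n) *
      (bellRatio (n + 1) * Real.log n / n) * (Real.log (Real.log n))⁻¹) atTop (𝓝 0) := by
  have hinv := tendsto_inv_atTop_zero.comp tendsto_log_log_natCast
  have h := (tendsto_bellRatio_mul_log_div.mul
    ((tendsto_bellRatio_mul_log_div.comp (tendsto_add_atTop_nat 1)).const_mul 2)).mul hinv
  rw [mul_zero] at h
  refine squeeze_zero' ?_ ?_ h
  · filter_upwards [tendsto_log_natCast.eventually_gt_atTop 0,
      tendsto_log_log_natCast.eventually_gt_atTop 0] with n h1 h2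
    have := bellRatio_pos n
    have := bellRatio_pos (n + 1)
    positivity
  · filter_upwards [tendsto_log_natCast.eventually_gt_atTop 0,
      tendsto_log_log_natCast.eventually_gt_atTop 0, eventually_ge_atTop 1] with n h1 h2 h3
    have hR := bellRatio_pos n
    have hR' := bellRatio_pos (n + 1)
    have h3' : (1 : ℝ) ≤ n := Nat.one_le_cast.2 h3
    have hlog : Real.log n ≤ Real.log (n + 1 : ℕ) :=
      Real.log_le_log (by linarith) (by push_cast; linarith)
    have key : bellRatio (n + 1) * Real.log n / n ≤
        2 * (bellRatio (n + 1) * Real.log (n + 1 : ℕ) / (n + 1 : ℕ)) := by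
      calc bellRatio (n + 1) * Real.log n / n
          ≤ bellRatio (n + 1) * Real.log (n + 1 : ℕ) / (((n + 1 : ℕ) : ℝ) / 2) := by
            gcongr
            push_cast; linarith
        _ = _ := by field_simp
    simp only [Function.comp_apply]
    gcongr

theorem meanCro_expansion :
    ∃ ε : ℕ → ℝ, Tendsto ε atTop (𝓝 0) ∧
      ∀ᶠ n : ℕ in atTop,
        meanCro n =
          (n : ℝ) ^ 2 / (2 * Real.log n) *
            (1 + Real.log (Real.log n) / Real.log n * (1 + ε n)) := by
  -- the error term is the one that makes the equation an identity
  refine ⟨fun n => (meanCro n * (2 * Real.log n) / (n : ℝ) ^ 2 - 1) *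
    (Real.log n / Real.log (Real.log n)) - 1, ?_, ?_⟩
  · have hinv := tendsto_inv_atTop_zero.comp tendsto_log_log_natCast
    have hpow : ∀ k : ℕ, Tendsto (fun n : ℕ => Real.log n ^ k / (n : ℝ)) atTop (𝓝 0) := fun k =>
      ((Real.isLittleO_pow_log_id_atTop (n := k)).tendsto_div_nhds_zero).comp
        tendsto_natCast_atTop_atTop
    -- the contribution of the terms of lower order in `n`
    have hlow : Tendsto (fun n : ℕ => ((9 / 2) * ((bellRatio n * Real.log n / n) *
        (Real.log n ^ 1 / (n : ℝ))) + Real.log n ^ 2 / (n : ℝ) +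
        (1 / 2) * (Real.log n ^ 2 / (n : ℝ) * (n : ℝ)⁻¹)) *
        (Real.log (Real.log n))⁻¹) atTop (𝓝 0) := by
      have := ((((tendsto_bellRatio_mul_log_div.mul (hpow 1)).const_mul (9 / 2)).add
        (hpow 2)).add (((hpow 2).mul (tendsto_inv_atTop_zero.comp
          tendsto_natCast_atTop_atTop)).const_mul (1 / 2))).mul hinv
      simpa using this
    have h := ((tendsto_bellRatio_expansion.sub_const 1).sub
      (tendsto_bellRatio_mul_bellRatio_succ.const_mul (5 / 2))).add hlow
    simp only [sub_self, mul_zero, add_zero] at h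
    refine h.congr' ?_
    filter_upwards [tendsto_log_natCast.eventually_gt_atTop 0,
      tendsto_log_log_natCast.eventually_gt_atTop 0, eventually_gt_atTop 0] with n h1 h2 h3
    have h3' : (0 : ℝ) < n := Nat.cast_pos.2 h3
    have hmean : meanCro n = -(5 / 4) * (bellRatio (n + 1) * bellRatio n) +
        (n / 2 + 9 / 4) * bellRatio n + n / 2 + 1 / 4 := by
      rw [meanCro_eq, bellRatio, bellRatio, div_mul_div_cancel₀]
      exact Nat.cast_ne_zero.2 (bell_pos _).ne'
    rw [hmean]
    field_simp
    ring
  · filter_upwards [tendsto_log_natCast.eventually_gt_atTop 0,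
      tendsto_log_log_natCast.eventually_gt_atTop 0, eventually_gt_atTop 0] with n h1 h2 h3
    have h3' : (0 : ℝ) < n := Nat.cast_pos.2 h3
    field_simp
    ring

end LinearCrossing

theorem theorem2p3 :
    (∀ n : ℕ,
      LinearCrossing.meanCro n =
        -(5 / 4 : ℝ) * ((Nat.bell (n + 2) : ℝ) / (Nat.bell n : ℝ))
          + ((n : ℝ) / 2 + 9 / 4) * ((Nat.bell (n + 1) : ℝ) / (Nat.bell n : ℝ))
          + (n : ℝ) / 2 + 1 / 4) ∧
    (∃ ε : ℕ → ℝ, Tendsto ε atTop (𝓝 0) ∧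
      ∀ᶠ n : ℕ in atTop,
        LinearCrossing.meanCro n =
          (n : ℝ) ^ 2 / (2 * Real.log n) *
            (1 + Real.log (Real.log n) / Real.log n * (1 + ε n))) ∧
    (∀ n k : ℕ, 1 ≤ k → k ≤ n →
      LinearCrossing.meanCroBlocks n k =
        (1 / 2 : ℝ) * n * ((k : ℝ) - 1) - (5 / 2 : ℝ) * (Nat.choose k 2 : ℝ)
          + (3 / 2 : ℝ) * ((n : ℝ) + 1 - k) *
            ((Nat.stirlingSecond n (k - 1) : ℝ) / (Nat.stirlingSecond n k : ℝ))) ∧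
    (∀ k : ℕ, 1 ≤ k →
      Tendsto
        (fun n : ℕ => LinearCrossing.meanCroBlocks n k -
          ((1 / 2 : ℝ) * n * ((k : ℝ) - 1) - (5 / 2 : ℝ) * (Nat.choose k 2 : ℝ)))
        atTop (𝓝 0)) :=
  ⟨LinearCrossing.meanCro_eq, LinearCrossing.meanCro_expansion,
    fun _ _ => LinearCrossing.meanCroBlocks_eq, LinearCrossing.tendsto_meanCroBlocks⟩
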